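/- Let $m\ge 3$ and $d\ge 0$ be integers. For commutative association schemes $\mathcal X=(X,\{R_i\}_{0\le i\le d})$ and $\mathcal Y=(Y,\{S_j\}_{0\le j\le e})$, the wreath product $\mathcal X\wr\mathcal Y$ is the $(d+e)$-class scheme on $X\times Y$ whose relations are $W_0$, the diagonal; $W_k=\{((x_1,y),(x_2,y)):(x_1,x_2)\in R_k,\ y\in Y\}$ for $1\le k\le d$; and $W_k=\{((x_1,y_1),(x_2,y_2)):x_1,x_2\in X,\ (y_1,y_2)\in S_{k-d}\}$ for $d+1\le k\le d+e$. Let $K_m$ be the one-class scheme on $[m]=\{1,\dots,m\}$, and let $(K_m)^{\wr d}=K_m\wr\cdots\wr K_m$ ($d$ factors) be the resulting $d$-class scheme on $X=[m]^d$, with relations $R_0,\dots,R_d$ (for $d=0$, the one-point scheme). Let $A_i\in M_X(\mathbb C)$ be the adjacency matrix of $R_i$. Fix an arbitrary base vertex $x\in X$; let $E_i^*=E_i^*(x)$ be the diagonal matrix with $(E_i^*)_{yy}=1$ if $(x,y)\in R_i$ and $0$ otherwise. The Terwilliger algebra $\mathcal T=\mathcal T(x)$ is the subalgebra of $M_X(\mathbb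 C)$ generated by $A_0,\dots,A_d,E_0^*,\dots,E_d^*$. It acts on the standard module $V=\mathbb C^X$ of column vectors by left multiplication. The primary module $\mathcal P$ is the $\mathcal T$-submodule of $V$ generated by the vectors $E_i^*\mathbf 1$, $0\le i\le d$, where $\mathbf 1$ is the all-ones vector. Then: 1. $\dim_{\mathbb C}\mathcal T=(d+1)^2+\tfrac12 d(d+1)$. 2. $\mathcal T\cong M_{d+1}(\mathbb C)\oplus M_1(\mathbb C)^{\oplus d(d+1)/2}$ as $\mathbb C$-algebras. 3. $\mathcal P$ is irreducible of dimension $d+1$. 4. Every irreducible $\mathcal T$-submodule $W\ne\mathcal P$ of $V$ has dimension $1$, and these $W$ form exactly $\tfrac12 d(d+1)$ isomorphism classes of $\mathcal T$-modules. 5. Every irreducible $\mathcal T$-module is isomorphic to a $\mathcal T$-submodule of $V$. -/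

import Mathlib

open scoped Matrix.Module

/-- A `d`-class commutative association scheme on a finite set `X`.  The relations
`R₀, …, R_d`, which partition `X × X`, are encoded by the function `rel` sending a pair
`(x, y)` to the index `i` with `(x, y) ∈ R_i`. -/
structure AssociationScheme (X : Type*) [Fintype X] (d : ℕ) where
  rel : X → X → Fin (d + 1)
  /-- every relation is nonempty -/
  nonempty : ∀ i, ∃ x y, rel x y = i
  /-- `R₀` is the diagonal -/
  diag : ∀ x y, rel x y = 0 ↔ x = y
  /-- the transpose of each relation is again one of the relations -/
  transpose : ∀ i, ∃ i', ∀ x y, rel y x = i ↔ rel x y = i'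
  /-- the intersection numbers `p_{ij}^h` are well defined: the number of `z` with
  `(x, z) ∈ R_i`, `(z, y) ∈ R_j` depends only on `i`, `j` and the relation containing `(x, y)` -/
  intersection : ∀ i j x y x' y', rel x y = rel x' y' →
    (Finset.univ.filter fun z => rel x z = i ∧ rel z y = j).card =
      (Finset.univ.filter fun z => rel x' z = i ∧ rel z y' = j).card
  /-- commutativity, `p_{ij}^h = p_{ji}^h` -/
  comm : ∀ i j x y,
    (Finset.univ.filter fun z => rel x z = i ∧ rel z y = j).card =
      (Finset.univ.filter fun z => rel x z = j ∧ rel z y = i).card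

namespace AssociationScheme

section Wreath

variable {X Y : Type*} [Fintype X] [Fintype Y] {d e : ℕ}

theorem intersection_nat (R : AssociationScheme X d) (i j : ℕ) (x y x' y' : X)
    (h : R.rel x y = R.rel x' y') :
    (Finset.univ.filter fun z => (R.rel x z).val = i ∧ (R.rel z y).val = j).card =
      (Finset.univ.filter fun z => (R.rel x' z).val = i ∧ (R.rel z y').val = j).card := by
  by_cases hi : i < d + 1
  · by_cases hj : j < d + 1
    · have := R.intersection ⟨i, hi⟩ ⟨j, hj⟩ x y x' y' h
      simpa [Fin.ext_iff] using this
    · have H : ∀ z w, (R.rel z w).val ≠ j := fun z w => by omega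
      simp [H]
  · have H : ∀ z w, (R.rel z w).val ≠ i := fun z w => by omega
    simp [H]

theorem comm_nat (R : AssociationScheme X d) (i j : ℕ) (x y : X) :
    (Finset.univ.filter fun z => (R.rel x z).val = i ∧ (R.rel z y).val = j).card =
      (Finset.univ.filter fun z => (R.rel x z).val = j ∧ (R.rel z y).val = i).card := by
  by_cases hi : i < d + 1
  · by_cases hj : j < d + 1
    · have := R.comm ⟨i, hi⟩ ⟨j, hj⟩ x y
      simpa [Fin.ext_iff] using this
    · have H : ∀ z w, (R.rel z w).val ≠ j := fun z w => by omega
      simp [H]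
  · have H : ∀ z w, (R.rel z w).val ≠ i := fun z w => by omega
    simp [H]

theorem card_out_eq_sum (R : AssociationScheme X d) (i : ℕ) (x : X) :
    (Finset.univ.filter fun z => (R.rel x z).val = i).card =
      ∑ j : Fin (d + 1),
        (Finset.univ.filter fun z => (R.rel x z).val = i ∧ (R.rel z x).val = j.val).card := by
  rw [Finset.card_eq_sum_card_fiberwise (f := fun z => R.rel z x) (t := Finset.univ)
    (fun _ _ => Finset.mem_coe.2 (Finset.mem_univ _))]
  refine Finset.sum_congr rfl fun j _ => ?_
  rw [Finset.filter_filter]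
  simp only [Fin.ext_iff]

theorem card_in_eq_sum (R : AssociationScheme X d) (i : ℕ) (x : X) :
    (Finset.univ.filter fun z => (R.rel z x).val = i).card =
      ∑ j : Fin (d + 1),
        (Finset.univ.filter fun z => (R.rel x z).val = j.val ∧ (R.rel z x).val = i).card := by
  rw [Finset.card_eq_sum_card_fiberwise (f := fun z => R.rel x z) (t := Finset.univ)
    (fun _ _ => Finset.mem_coe.2 (Finset.mem_univ _))]
  refine Finset.sum_congr rfl fun j _ => ?_
  rw [Finset.filter_filter]
  simp only [Fin.ext_iff, and_comm]

theorem card_out_eq_in (R : AssociationScheme X d) (i : ℕ) (x y : X) :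
    (Finset.univ.filter fun z => (R.rel x z).val = i).card =
      (Finset.univ.filter fun z => (R.rel z y).val = i).card := by
  rw [card_out_eq_sum, card_in_eq_sum]
  refine Finset.sum_congr rfl fun j _ => ?_
  rw [R.comm_nat]
  exact R.intersection_nat _ _ _ _ _ _ (((R.diag x x).2 rfl).trans ((R.diag y y).2 rfl).symm)

theorem rel_val_eq_zero (R : AssociationScheme X d) (x y : X) :
    (R.rel x y).val = 0 ↔ x = y := by
  rw [← R.diag x y, Fin.ext_iff]; rfl

/-- The index of the relation of the wreath product that contains a given pair: pairs in the
same copy of `X` are related as in the first scheme, and pairs in different copies as the indices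
of the copies are related in the second scheme, with the index shifted by `d`. -/
def wreathRel [DecidableEq Y] (R : AssociationScheme X d) (S : AssociationScheme Y e)
    (p q : X × Y) : Fin (d + e + 1) :=
  if p.2 = q.2 then ⟨(R.rel p.1 q.1).val, by omega⟩ else ⟨d + (S.rel p.2 q.2).val, by omega⟩

theorem wreathRel_val [DecidableEq Y] (R : AssociationScheme X d) (S : AssociationScheme Y e)
    (p q : X × Y) : (wreathRel R S p q).val =
      if p.2 = q.2 then (R.rel p.1 q.1).val else d + (S.rel p.2 q.2).val := by
  unfold wreathRel; split <;> rfl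

/-- Contribution of the copies of `X` other than those of the two given points. -/
def wreathFar [DecidableEq Y] (S : AssociationScheme Y e) (d i j : ℕ) (b c : Y) : ℕ :=
  (Finset.univ.filter fun v => (v ≠ b ∧ v ≠ c) ∧
    d + (S.rel b v).val = i ∧ d + (S.rel v c).val = j).card

theorem wreathFar_eq [DecidableEq Y] (S : AssociationScheme Y e) (d i j : ℕ) (b c : Y) :
    wreathFar S d i j b c = if d < i ∧ d < j then
      (Finset.univ.filter fun v => (S.rel b v).val = i - d ∧ (S.rel v c).val = j - d).card
      else 0 := by
  unfold wreathFar
  split_ifs with h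
  · congr 1
    ext v
    simp only [Finset.mem_filter, Finset.mem_univ, true_and]
    constructor
    · rintro ⟨-, h1, h2⟩; omega
    · rintro ⟨h1, h2⟩
      refine ⟨⟨?_, ?_⟩, by omega, by omega⟩
      · intro hv; have := (S.rel_val_eq_zero b v).2 hv.symm; omega
      · intro hv; have := (S.rel_val_eq_zero v c).2 hv; omega
  · rw [Finset.card_eq_zero, Finset.filter_eq_empty_iff]
    rintro v - ⟨⟨h1, h2⟩, h3, h4⟩
    have h5 := mt (S.rel_val_eq_zero b v).1 (Ne.symm h1)
    have h6 := mt (S.rel_val_eq_zero v c).1 h2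
    omega

theorem wreathFar_congr [DecidableEq Y] (S : AssociationScheme Y e) (d i j : ℕ) (b c b' c' : Y)
    (h : S.rel b c = S.rel b' c') : wreathFar S d i j b c = wreathFar S d i j b' c' := by
  rw [wreathFar_eq, wreathFar_eq, S.intersection_nat _ _ _ _ _ _ h]

theorem wreathFar_comm [DecidableEq Y] (S : AssociationScheme Y e) (d i j : ℕ) (b c : Y) :
    wreathFar S d i j b c = wreathFar S d j i b c := by
  rw [wreathFar_eq, wreathFar_eq, S.comm_nat]
  simp only [and_comm]

theorem wreath_count_far [DecidableEq Y] (R : AssociationScheme X d) (S : AssociationScheme Y e)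
    (i j : ℕ) (p q : X × Y) :
    ∑ v, (if v ≠ p.2 ∧ v ≠ q.2 then (Finset.univ.filter fun u : X =>
      (wreathRel R S p (u, v)).val = i ∧ (wreathRel R S (u, v) q).val = j).card else 0) =
      wreathFar S d i j p.2 q.2 * Fintype.card X := by
  unfold wreathFar
  rw [Finset.card_filter, Finset.sum_mul]
  refine Finset.sum_congr rfl fun v _ => ?_
  by_cases hv : v ≠ p.2 ∧ v ≠ q.2
  · simp only [wreathRel_val, Ne.symm hv.1, hv.2, if_false]
    by_cases h : d + (S.rel p.2 v).val = i ∧ d + (S.rel v q.2).val = j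
    · simp [h, Finset.card_univ]
    · simp [h]
  · simp [hv]

theorem wreath_count_split [DecidableEq Y] (R : AssociationScheme X d)
    (S : AssociationScheme Y e) (i j : ℕ) (p q : X × Y) :
    (Finset.univ.filter fun z : X × Y =>
      (wreathRel R S p z).val = i ∧ (wreathRel R S z q).val = j).card =
    ∑ v, (Finset.univ.filter fun u : X =>
      (wreathRel R S p (u, v)).val = i ∧ (wreathRel R S (u, v) q).val = j).card := by
  simp only [Finset.card_filter]
  rw [Fintype.sum_prod_type_right]

theorem wreath_count_same [DecidableEq Y] (R : AssociationScheme X d) (S : AssociationScheme Y e)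
    (i j : ℕ) (p q : X × Y) (h : p.2 = q.2) :
    (Finset.univ.filter fun z : X × Y =>
      (wreathRel R S p z).val = i ∧ (wreathRel R S z q).val = j).card =
    (Finset.univ.filter fun u => (R.rel p.1 u).val = i ∧ (R.rel u q.1).val = j).card +
      wreathFar S d i j p.2 q.2 * Fintype.card X := by
  rw [wreath_count_split, ← wreath_count_far R S,
    ← Finset.add_sum_erase Finset.univ _ (Finset.mem_univ p.2)]
  conv_rhs => rw [← Finset.add_sum_erase Finset.univ _ (Finset.mem_univ p.2)]
  have h1 : ∀ u, (wreathRel R S p (u, p.2)).val = (R.rel p.1 u).val := fun u => by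
    simp [wreathRel_val]
  have h2 : ∀ u, (wreathRel R S (u, p.2) q).val = (R.rel u q.1).val := fun u => by
    simp [wreathRel_val, h]
  simp only [h1, h2, ne_eq, not_true_eq_false, false_and, if_false, zero_add]
  congr 1
  refine Finset.sum_congr rfl fun v hv => ?_
  have hv' := Finset.ne_of_mem_erase hv
  rw [if_pos ⟨hv', h ▸ hv'⟩]

theorem wreath_count_diff [DecidableEq Y] (R : AssociationScheme X d) (S : AssociationScheme Y e)
    (i j : ℕ) (p q : X × Y) (h : p.2 ≠ q.2) :
    (Finset.univ.filter fun z : X × Y =>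
      (wreathRel R S p z).val = i ∧ (wreathRel R S z q).val = j).card =
    (if d + (S.rel p.2 q.2).val = j then
      (Finset.univ.filter fun u => (R.rel p.1 u).val = i).card else 0) +
    ((if d + (S.rel p.2 q.2).val = i then
      (Finset.univ.filter fun u => (R.rel u q.1).val = j).card else 0) +
      wreathFar S d i j p.2 q.2 * Fintype.card X) := by
  have hq : q.2 ∈ Finset.univ.erase p.2 := Finset.mem_erase.2 ⟨h.symm, Finset.mem_univ _⟩
  rw [wreath_count_split, ← wreath_count_far R S,
    ← Finset.add_sum_erase Finset.univ _ (Finset.mem_univ p.2), ← Finset.add_sum_erase _ _ hq]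
  conv_rhs => rw [← Finset.add_sum_erase Finset.univ _ (Finset.mem_univ p.2),
    ← Finset.add_sum_erase _ _ hq]
  have h1 : ∀ u, (wreathRel R S p (u, p.2)).val = (R.rel p.1 u).val := fun u => by
    simp [wreathRel_val]
  have h2 : ∀ u, (wreathRel R S (u, q.2) q).val = (R.rel u q.1).val := fun u => by
    simp [wreathRel_val]
  have h3 : ∀ u, (wreathRel R S (u, p.2) q).val = d + (S.rel p.2 q.2).val := fun u => by
    simp [wreathRel_val, h]
  have h4 : ∀ u, (wreathRel R S p (u, q.2)).val = d + (S.rel p.2 q.2).val := fun u => by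
    simp [wreathRel_val, h]
  simp only [h1, h2, h3, h4, ne_eq, not_true_eq_false, false_and, and_false, if_false, zero_add]
  congr 1
  · split_ifs with h5 <;> simp [h5]
  congr 1
  · split_ifs with h5 <;> simp [h5]
  refine Finset.sum_congr rfl fun v hv => ?_
  have hv1 := Finset.ne_of_mem_erase hv
  have hv2 := Finset.ne_of_mem_erase (Finset.mem_of_mem_erase hv)
  rw [if_pos ⟨hv2, hv1⟩]

/-- The wreath product `R ≀ S` of two schemes, on `X × Y`, viewed as the disjoint union of the
copies `X × {y}` of `X`. -/
def wreath [DecidableEq Y] (R : AssociationScheme X d) (S : AssociationScheme Y e) :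
    AssociationScheme (X × Y) (d + e) where
  rel := wreathRel R S
  nonempty := by
    intro k
    by_cases hk : k.val < d + 1
    · obtain ⟨a, b, hab⟩ := R.nonempty ⟨k.val, hk⟩
      obtain ⟨y, -, -⟩ := S.nonempty 0
      exact ⟨(a, y), (b, y), Fin.ext (by simp [wreathRel_val, hab])⟩
    · obtain ⟨y, z, hyz⟩ := S.nonempty ⟨k.val - d, by omega⟩
      obtain ⟨a, -, -⟩ := R.nonempty 0
      have hne : y ≠ z := fun h => by
        have := (S.rel_val_eq_zero y z).2 h
        rw [hyz] at this
        simp only at this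
        omega
      refine ⟨(a, y), (a, z), Fin.ext ?_⟩
      simp only [wreathRel_val, hne, if_false, hyz]
      omega
  diag := by
    intro p q
    rw [Fin.ext_iff, wreathRel_val, Prod.ext_iff]
    have h1 := R.rel_val_eq_zero p.1 q.1
    have h2 := S.rel_val_eq_zero p.2 q.2
    simp only [Fin.val_zero]
    split_ifs with h
    · rw [h1]; simp [h]
    · have := mt h2.1 h
      simp only [h, and_false, iff_false]
      omega
  transpose := by
    intro k
    by_cases hk : k.val < d + 1
    · obtain ⟨i', hi'⟩ := R.transpose ⟨k.val, hk⟩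
      refine ⟨⟨i'.val, by omega⟩, fun p q => ?_⟩
      have h1 := hi' p.1 q.1
      have h2 := S.rel_val_eq_zero p.2 q.2
      have h3 := S.rel_val_eq_zero q.2 p.2
      simp only [Fin.ext_iff, wreathRel_val] at h1 ⊢
      by_cases h : p.2 = q.2
      · simpa [h] using h1
      · have h2' := mt h2.1 h
        have h3' := mt h3.1 (Ne.symm h)
        simp only [h, Ne.symm h, if_false]
        omega
    · obtain ⟨i', hi'⟩ := S.transpose ⟨k.val - d, by omega⟩
      have hi0 : i'.val ≠ 0 := by
        intro h0
        obtain ⟨y, -, -⟩ := S.nonempty 0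
        have h1 := (hi' y y).2 (Fin.ext (((S.rel_val_eq_zero y y).2 rfl).trans h0.symm))
        have h2 := (S.rel_val_eq_zero y y).2 rfl
        rw [h1] at h2
        simp only at h2
        omega
      refine ⟨⟨d + i'.val, by omega⟩, fun p q => ?_⟩
      have h1 := hi' p.2 q.2
      have h2 := (R.rel p.1 q.1).isLt
      have h3 := (R.rel q.1 p.1).isLt
      simp only [Fin.ext_iff, wreathRel_val] at h1 ⊢
      by_cases h : p.2 = q.2
      · simp only [h, if_true]
        omega
      · simp only [h, Ne.symm h, if_false]
        omega
  intersection := by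
    intro i j p q p' q' h
    simp only [Fin.ext_iff, wreathRel_val] at h
    simp only [Fin.ext_iff]
    have a1 := (R.rel p.1 q.1).isLt
    have a2 := (R.rel p'.1 q'.1).isLt
    have b1 := S.rel_val_eq_zero p.2 q.2
    have b2 := S.rel_val_eq_zero p'.2 q'.2
    by_cases hp : p.2 = q.2
    · have hp' : p'.2 = q'.2 := by
        by_contra hc
        have := mt b2.1 hc
        simp only [hp, hc, if_true, if_false] at h
        omega
      simp only [hp, hp', if_true] at h
      rw [wreath_count_same _ _ _ _ _ _ hp, wreath_count_same _ _ _ _ _ _ hp',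
        R.intersection_nat _ _ _ _ _ _ (Fin.ext h),
        wreathFar_congr S d i j _ _ _ _
          (((S.diag _ _).2 hp).trans ((S.diag _ _).2 hp').symm)]
    · have hp' : p'.2 ≠ q'.2 := by
        intro hc
        have := mt b1.1 hp
        simp only [hp, hc, if_true, if_false] at h
        omega
      simp only [hp, hp', if_false] at h
      have hS : S.rel p.2 q.2 = S.rel p'.2 q'.2 := Fin.ext (by omega)
      rw [wreath_count_diff _ _ _ _ _ _ hp, wreath_count_diff _ _ _ _ _ _ hp', hS,
        wreathFar_congr S d i j _ _ _ _ hS,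
        R.card_out_eq_in _ p.1 p.1, ← R.card_out_eq_in _ p'.1 p.1,
        ← R.card_out_eq_in _ p.1 q.1, R.card_out_eq_in _ p.1 q'.1]
  comm := by
    intro i j p q
    simp only [Fin.ext_iff]
    by_cases hp : p.2 = q.2
    · rw [wreath_count_same _ _ _ _ _ _ hp, wreath_count_same _ _ _ _ _ _ hp, R.comm_nat,
        wreathFar_comm]
    · rw [wreath_count_diff _ _ _ _ _ _ hp, wreath_count_diff _ _ _ _ _ _ hp,
        wreathFar_comm S d i j, R.card_out_eq_in i p.1 q.1, R.card_out_eq_in j p.1 q.1]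
      ring

/-- The scheme obtained by renaming the points along a bijection. -/
def relabel (R : AssociationScheme X d) (f : Y ≃ X) : AssociationScheme Y d where
  rel x y := R.rel (f x) (f y)
  nonempty i := by
    obtain ⟨x, y, h⟩ := R.nonempty i
    exact ⟨f.symm x, f.symm y, by simpa using h⟩
  diag x y := by rw [R.diag, f.apply_eq_iff_eq]
  transpose i := by
    obtain ⟨i', h⟩ := R.transpose i
    exact ⟨i', fun x y => h _ _⟩
  intersection i j x y x' y' h := by
    have key : ∀ a b : Y, (Finset.univ.filter fun z : Y =>
        R.rel (f a) (f z) = i ∧ R.rel (f z) (f b) = j).card =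
        (Finset.univ.filter fun z : X => R.rel (f a) z = i ∧ R.rel z (f b) = j).card :=
      fun a b => Finset.card_equiv f (by simp)
    rw [key, key]
    exact R.intersection i j _ _ _ _ h
  comm i j x y := by
    have key : ∀ i j, (Finset.univ.filter fun z : Y =>
        R.rel (f x) (f z) = i ∧ R.rel (f z) (f y) = j).card =
        (Finset.univ.filter fun z : X => R.rel (f x) z = i ∧ R.rel z (f y) = j).card :=
      fun i j => Finset.card_equiv f (by simp)
    rw [key, key]
    exact R.comm i j _ _

end Wreath

/-- The `0`-class scheme on a one-point set. -/
def onePoint (X : Type*) [Fintype X] [Unique X] : AssociationScheme X 0 where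
  rel _ _ := 0
  nonempty i := ⟨default, default, by omega⟩
  diag x y := by simp [Subsingleton.elim x y]
  transpose i := ⟨i, fun _ _ => Iff.rfl⟩
  intersection _ _ _ _ _ _ _ := rfl
  comm i j _ _ := by rw [show i = j by omega]

/-- The one-class scheme `K_m`, with `A₁ = J - I`. -/
def oneClass (m : ℕ) (hm : 2 ≤ m) : AssociationScheme (Fin m) 1 where
  rel x y := if x = y then 0 else 1
  nonempty i := by
    have hne : (⟨0, by omega⟩ : Fin m) ≠ ⟨1, by omega⟩ := by simp
    fin_cases i
    · exact ⟨⟨0, by omega⟩, ⟨0, by omega⟩, by simp⟩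
    · exact ⟨⟨0, by omega⟩, ⟨1, by omega⟩, by simp⟩
  diag x y := by simp
  transpose i := ⟨i, fun x y => by simp only [eq_comm]⟩
  intersection i j x y x' y' h := by
    have hxy : x = y ↔ x' = y' := by
      by_cases h1 : x = y <;> by_cases h2 : x' = y' <;> simp_all
    obtain ⟨σ, hσ, hσ'⟩ : ∃ σ : Equiv.Perm (Fin m), σ x = x' ∧ σ y = y' := by
      by_cases h1 : x = y
      · exact ⟨Equiv.swap x x', by simp, by rw [← hxy.1 h1, ← h1]; simp⟩
      · have h2 : x' ≠ y' := fun h => h1 (hxy.2 h)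
        have h3 : Equiv.swap x x' y ≠ x' := fun h => h1 (by
          have := congrArg (Equiv.swap x x') h
          simpa using this.symm)
        refine ⟨(Equiv.swap x x').trans (Equiv.swap (Equiv.swap x x' y) y'), ?_, ?_⟩
        · simp only [Equiv.trans_apply, Equiv.swap_apply_left]
          exact Equiv.swap_apply_of_ne_of_ne h3.symm h2
        · simp
    refine Finset.card_equiv σ fun z => ?_
    simp [← hσ, ← hσ']
  comm i j x y := by
    refine Finset.card_equiv (Equiv.swap x y) fun z => ?_
    simp only [Finset.mem_filter, Finset.mem_univ, true_and]
    have h1 : x = Equiv.swap x y z ↔ z = y := by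
      rw [eq_comm, Equiv.swap_apply_eq_iff, Equiv.swap_apply_left]
    have h2 : Equiv.swap x y z = y ↔ x = z := by
      rw [Equiv.swap_apply_eq_iff, Equiv.swap_apply_right, eq_comm]
    simp only [h1, h2, and_comm]

/-- The wreath power `(K_m)^{≀ d} = K_m ≀ ⋯ ≀ K_m` (`d` factors) on the set of `d`-tuples of
elements of an `m`-element set: `(K_m)^{≀ (d+1)} = (K_m)^{≀ d} ≀ K_m`, a `(d+1)`-tuple being
identified with the pair formed by its first `d` entries and its last entry. -/
def wreathPower (m : ℕ) (hm : 2 ≤ m) : (d : ℕ) → AssociationScheme (Fin d → Fin m) d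
  | 0 => onePoint (Fin 0 → Fin m)
  | d + 1 => ((wreathPower m hm d).wreath (oneClass m hm)).relabel
      ((Fin.snocEquiv fun _ : Fin (d + 1) => Fin m).symm.trans (Equiv.prodComm _ _))

section Terwilliger

variable {X : Type*} [Fintype X] [DecidableEq X] {d : ℕ}

/-- The adjacency matrix `A_i`. -/
def adjMatrix (R : AssociationScheme X d) (i : Fin (d + 1)) : Matrix X X ℂ :=
  Matrix.of fun x y => if R.rel x y = i then 1 else 0

/-- The dual idempotent `E_i^* = E_i^*(x)`, the projection onto the `i`-th subconstituent. -/
def dualIdempotent (R : AssociationScheme X d) (x : X) (i : Fin (d + 1)) : Matrix X X ℂ :=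
  Matrix.diagonal fun y => if R.rel x y = i then 1 else 0

/-- The Bose-Mesner algebra. -/
def boseMesner (R : AssociationScheme X d) : Subalgebra ℂ (Matrix X X ℂ) :=
  Algebra.adjoin ℂ (Set.range R.adjMatrix)

/-- The dual Bose-Mesner algebra with respect to `x`. -/
def dualBoseMesner (R : AssociationScheme X d) (x : X) : Subalgebra ℂ (Matrix X X ℂ) :=
  Algebra.adjoin ℂ (Set.range (R.dualIdempotent x))

/-- The Terwilliger algebra with respect to `x`: the subalgebra generated by the Bose-Mesner
algebra and the dual Bose-Mesner algebra.  Its standard module is `X → ℂ`, on which matrices act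
by `Matrix.Module.matrixModule`, that is, by multiplication of column vectors. -/
def terwilliger (R : AssociationScheme X d) (x : X) : Subalgebra ℂ (Matrix X X ℂ) :=
  R.boseMesner ⊔ R.dualBoseMesner x

/-- The primary module: the submodule of the standard module generated by the vectors
`E_i^* 𝟏`, the characteristic vectors of the subconstituents. -/
def primaryModule (R : AssociationScheme X d) (x : X) :
    Submodule (R.terwilliger x) (X → ℂ) :=
  Submodule.span (R.terwilliger x)
    (Set.range fun i => (R.dualIdempotent x i).mulVec fun _ => (1 : ℂ))

/-- Irreducible submodules of the standard module other than the primary module. -/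
abbrev NonprimaryIrreducible (R : AssociationScheme X d) (x : X) : Type _ :=
  {W : Submodule (R.terwilliger x) (X → ℂ) //
    IsSimpleModule (R.terwilliger x) W ∧ W ≠ R.primaryModule x}

/-- Isomorphism of modules over the Terwilliger algebra. -/
def isoSetoid (R : AssociationScheme X d) (x : X) : Setoid (R.NonprimaryIrreducible x) where
  r W W' := Nonempty (W.1 ≃ₗ[R.terwilliger x] W'.1)
  iseqv :=
    { refl := fun _ => ⟨LinearEquiv.refl _ _⟩
      symm := fun ⟨f⟩ => ⟨f.symm⟩
      trans := fun ⟨f⟩ ⟨g⟩ => ⟨f.trans g⟩ }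

end Terwilliger

end AssociationScheme

/-! The relation index of two tuples is an ultrametric: the 1-based position of the last entry where
they differ, or 0. So for `k < i` the sphere of radius `i` about the base vertex is a disjoint union
of balls of radius `k`, and averaging over them gives operators `B_{i,k}` (`blockMean`) with
`B_{i,k} B_{i,l} = B_{i,max(k,l)}`. Here `B_{i,0} = E_i^*`, while `B_{i,i}` is the rank-one
projection onto the constants of the sphere.

The differences `B_{i,k} - B_{i,k+1}` with `0 ≤ k < i ≤ d` are therefore `d(d+1)/2` orthogonal
idempotents. They are orthogonal to the `(d+1)^2` matrix units between constants on spheres, and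
together with the diagonal units they sum to the identity. They are nonzero because `m ≥ 3`: for `m
= 2` a sphere of radius `i` is a single ball of radius `i-1`, so `B_{i,i-1} = B_{i,i}`.

All of these lie in the Terwilliger algebra. Conversely `ballMatrix_mem_range` puts the adjacency
matrices in their span, so they form a basis of it (`terwilliger_eq_range`). The module statements
follow from this explicit Wedderburn decomposition: the matrix block acts irreducibly on the primary
module, and each remaining idempotent cuts out a component on which the algebra acts by scalars. -/

/-! ### Matrix units and complementary idempotents -/

/-- A system consisting of matrix units, the products of a column of `U` and a row of `U'`, and
of idempotents `F i`, all these being orthogonal to each other and adding up to the identity. -/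
structure IsWedderburnSystem {X n ι : Type*} [Fintype X] [DecidableEq X] [Fintype n]
    [DecidableEq n] [Fintype ι] (U : Matrix X n ℂ) (U' : Matrix n X ℂ)
    (F : ι → Matrix X X ℂ) : Prop where
  row_mul_col : U' * U = 1
  idem_mul_col : ∀ i, F i * U = 0
  row_mul_idem : ∀ i, U' * F i = 0
  idem_mul_self : ∀ i, F i * F i = F i
  idem_mul_of_ne : ∀ i j, i ≠ j → F i * F j = 0
  sum_eq_one : U * U' + ∑ i, F i = 1
  idem_ne_zero : ∀ i, F i ≠ 0

namespace IsWedderburnSystem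

variable {X n ι : Type*} [Fintype X] [DecidableEq X] [Fintype n] [DecidableEq n] [Fintype ι]
  {U : Matrix X n ℂ} {U' : Matrix n X ℂ} {F : ι → Matrix X X ℂ}

theorem reindex {κ : Type*} [Fintype κ] (h : IsWedderburnSystem U U' F) (e : κ ≃ ι) :
    IsWedderburnSystem U U' (F ∘ e) where
  row_mul_col := h.row_mul_col
  idem_mul_col i := h.idem_mul_col _
  row_mul_idem i := h.row_mul_idem _
  idem_mul_self i := h.idem_mul_self _
  idem_mul_of_ne i j hij := h.idem_mul_of_ne _ _ (e.injective.ne hij)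
  sum_eq_one := by rw [← h.sum_eq_one, ← e.sum_comp F]; rfl
  idem_ne_zero i := h.idem_ne_zero _

theorem sum_mul_idem (h : IsWedderburnSystem U U' F) (c : ι → ℂ) (j : ι) :
    (∑ i, c i • F i) * F j = c j • F j := by
  classical
  rw [Finset.sum_mul, Finset.sum_eq_single j]
  · rw [smul_mul_assoc, h.idem_mul_self]
  · intro i _ hij; rw [smul_mul_assoc, h.idem_mul_of_ne i j hij, smul_zero]
  · simp

theorem sum_mul_col (h : IsWedderburnSystem U U' F) (c : ι → ℂ) :
    (∑ i, c i • F i) * U = 0 := by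
  rw [Matrix.sum_mul]
  exact Finset.sum_eq_zero fun i _ => by rw [Matrix.smul_mul, h.idem_mul_col, smul_zero]

/-- Together with `mul_col`, this reads off the coordinates of an element of the span.
Multiplicativity, injectivity and the action on modules all reduce to these two products. -/
theorem mul_idem (h : IsWedderburnSystem U U' F) (a : Matrix n n ℂ) (c : ι → ℂ) (j : ι) :
    (U * a * U' + ∑ i, c i • F i) * F j = c j • F j := by
  rw [add_mul, h.sum_mul_idem, Matrix.mul_assoc, h.row_mul_idem, Matrix.mul_zero, zero_add]

theorem mul_col (h : IsWedderburnSystem U U' F) (a : Matrix n n ℂ) (c : ι → ℂ) :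
    (U * a * U' + ∑ i, c i • F i) * U = U * a := by
  rw [Matrix.add_mul, h.sum_mul_col, Matrix.mul_assoc, h.row_mul_col, Matrix.mul_one, add_zero]

/-- The homomorphism from a direct sum of matrix algebras. -/
noncomputable def algHom (h : IsWedderburnSystem U U' F) :
    (Matrix n n ℂ × (ι → Matrix (Fin 1) (Fin 1) ℂ)) →ₐ[ℂ] Matrix X X ℂ :=
  AlgHom.ofLinearMap
    { toFun := fun p : Matrix n n ℂ × (ι → Matrix (Fin 1) (Fin 1) ℂ) =>
        U * p.1 * U' + ∑ i, p.2 i 0 0 • F i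
      map_add' := fun p q => by
        simp only [Prod.fst_add, Prod.snd_add, Pi.add_apply, Matrix.add_apply, add_smul,
          Finset.sum_add_distrib, Matrix.mul_add, Matrix.add_mul]
        abel
      map_smul' := fun r p => by
        simp [smul_smul, Finset.smul_sum] }
    (by simpa [Matrix.mul_one] using h.sum_eq_one)
    (fun p q => by
      have h1 : ∀ i, (p.2 * q.2) i 0 0 = p.2 i 0 0 * q.2 i 0 0 := fun i => by
        simp [Matrix.mul_apply]
      simp only [LinearMap.coe_mk, AddHom.coe_mk, Prod.fst_mul, Prod.snd_mul, h1]
      rw [mul_add, Finset.mul_sum]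
      simp only [mul_smul_comm, h.mul_idem, smul_smul]
      rw [← Matrix.mul_assoc, ← Matrix.mul_assoc, ← Matrix.mul_assoc, h.mul_col]
      simp only [mul_comm])

theorem algHom_apply (h : IsWedderburnSystem U U' F)
    (p : Matrix n n ℂ × (ι → Matrix (Fin 1) (Fin 1) ℂ)) :
    h.algHom p = U * p.1 * U' + ∑ i, p.2 i 0 0 • F i := rfl

theorem mem_range_algHom (h : IsWedderburnSystem U U' F) (t : Matrix X X ℂ) :
    t ∈ h.algHom.range ↔ ∃ a : Matrix n n ℂ, ∃ c : ι → ℂ, t = U * a * U' + ∑ i, c i • F i :=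
  ⟨fun ⟨p, hp⟩ => ⟨p.1, fun i => p.2 i 0 0, hp.symm⟩,
    fun ⟨a, c, hac⟩ => ⟨(a, fun i => Matrix.of fun _ _ => c i), hac.symm⟩⟩

theorem col_mul_row_mem (h : IsWedderburnSystem U U' F) (a : Matrix n n ℂ) :
    U * a * U' ∈ h.algHom.range := (h.mem_range_algHom _).2 ⟨a, 0, by simp⟩

theorem idem_mem (h : IsWedderburnSystem U U' F) (i : ι) : F i ∈ h.algHom.range := by
  classical
  exact (h.mem_range_algHom _).2 ⟨0, Pi.single i 1, by simp [Pi.single_apply]⟩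

/-- Multiplying by `U'` on the left and `U` on the right recovers the matrix coordinate. Multiplying
by `F i` recovers the `i`-th scalar, because `F i ≠ 0`. -/
theorem injective_algHom (h : IsWedderburnSystem U U' F) : Function.Injective h.algHom := by
  rw [injective_iff_map_eq_zero]
  intro p hp
  have hp' : U * p.1 * U' + ∑ i, p.2 i 0 0 • F i = 0 := by
    rw [← h.algHom_apply, hp]
  refine Prod.ext ?_ (funext fun i => ?_)
  · have h1 := h.mul_col p.1 (fun i => p.2 i 0 0)
    rw [hp', Matrix.zero_mul] at h1
    have h2 := congrArg (U' * ·) h1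
    simpa [← Matrix.mul_assoc, h.row_mul_col] using h2.symm
  · have h1 := h.mul_idem p.1 (fun i => p.2 i 0 0) i
    rw [hp', Matrix.zero_mul] at h1
    have h2 := (smul_eq_zero.1 h1.symm).resolve_right (h.idem_ne_zero i)
    ext a b
    rw [Subsingleton.elim a 0, Subsingleton.elim b 0]
    exact h2

end IsWedderburnSystem

/-! ### Simple modules of an algebra with such a basis -/

/-- A subalgebra spanned by the matrix units and idempotents of a system. -/
structure IsWedderburnFrame {X n ι : Type*} [Fintype X] [DecidableEq X] [Fintype n]
    [DecidableEq n] [Fintype ι] (T : Subalgebra ℂ (Matrix X X ℂ)) (U : Matrix X n ℂ)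
    (U' : Matrix n X ℂ) (F : ι → Matrix X X ℂ) : Prop extends IsWedderburnSystem U U' F where
  eq_range : T = toIsWedderburnSystem.algHom.range

namespace IsWedderburnFrame

variable {X n ι : Type*} [Fintype X] [DecidableEq X] [Fintype n] [Fintype ι]
  {T : Subalgebra ℂ (Matrix X X ℂ)} {U : Matrix X n ℂ} {U' : Matrix n X ℂ}
  {F : ι → Matrix X X ℂ}

/-- The submodule of the standard module generated by the columns of `U`. -/
def primary (T : Subalgebra ℂ (Matrix X X ℂ)) (U : Matrix X n ℂ) : Submodule T (X → ℂ) :=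
  Submodule.span T (Set.range fun i => U.col i)

theorem mulVec_mem_primary (a : n → ℂ) : U.mulVec a ∈ primary T U := by
  rw [Matrix.mulVec_eq_sum]
  refine Submodule.sum_mem _ fun i _ => ?_
  have : U.col i ∈ primary T U := Submodule.subset_span ⟨i, rfl⟩
  rw [op_smul_eq_smul]
  exact ((primary T U).restrictScalars ℂ).smul_mem (a i) this

variable [DecidableEq n]

theorem mem_iff (h : IsWedderburnFrame T U U' F) (t : Matrix X X ℂ) :
    t ∈ T ↔ ∃ a : Matrix n n ℂ, ∃ c : ι → ℂ, t = U * a * U' + ∑ i, c i • F i := by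
  rw [h.eq_range, h.mem_range_algHom]

theorem reindex {κ : Type*} [Fintype κ] (h : IsWedderburnFrame T U U' F) (e : κ ≃ ι) :
    IsWedderburnFrame T U U' (F ∘ e) where
  toIsWedderburnSystem := h.toIsWedderburnSystem.reindex e
  eq_range := by
    ext t
    rw [h.mem_iff, IsWedderburnSystem.mem_range_algHom]
    refine exists_congr fun a => ⟨fun ⟨c, hc⟩ => ⟨c ∘ e, ?_⟩, fun ⟨c, hc⟩ => ⟨c ∘ e.symm, ?_⟩⟩
    · rw [hc, ← e.sum_comp]; rfl
    · rw [hc, ← e.sum_comp]; simp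

/-- The isomorphism with a direct sum of matrix algebras. -/
noncomputable def algEquiv (h : IsWedderburnFrame T U U' F) :
    T ≃ₐ[ℂ] (Matrix n n ℂ × (ι → Matrix (Fin 1) (Fin 1) ℂ)) :=
  (Subalgebra.equivOfEq _ _ h.eq_range).trans (AlgEquiv.ofInjective _ h.injective_algHom).symm

theorem finrank_eq (h : IsWedderburnFrame T U U' F) :
    Module.finrank ℂ T = Fintype.card n ^ 2 + Fintype.card ι := by
  rw [h.algEquiv.toLinearEquiv.finrank_eq, Module.finrank_prod, Module.finrank_matrix,
    Module.finrank_pi_fintype]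
  simp [Module.finrank_matrix, sq]

theorem isSemisimpleRing (h : IsWedderburnFrame T U U' F) : IsSemisimpleRing T :=
  h.algEquiv.symm.toRingEquiv.isSemisimpleRing

theorem smul_def (t : T) (v : X → ℂ) : t • v = t.1.mulVec v := rfl

/-- Every simple module embeds in the standard module, because a simple left ideal does: some
column of its elements is nonzero. -/
theorem exists_equiv_submodule (h : IsWedderburnFrame T U U' F) (W : Type*) [AddCommGroup W]
    [Module T W] (hW : IsSimpleModule T W) :
    ∃ W' : Submodule T (X → ℂ), IsSimpleModule T W' ∧ Nonempty (W ≃ₗ[T] W') := by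
  have := h.isSemisimpleRing
  obtain ⟨I, ⟨f⟩⟩ := IsSemisimpleRing.exists_linearEquiv_ideal_of_isSimpleModule T W
  have : IsSimpleModule T I := IsSimpleModule.congr f.symm
  have := IsSimpleModule.nontrivial T I
  obtain ⟨t, ht⟩ := exists_ne (0 : I)
  have ht' : (t : T).1 ≠ 0 := fun h0 => ht (Subtype.ext (Subtype.ext h0))
  obtain ⟨y, hy⟩ : ∃ y, (t : T).1.mulVec (Pi.single y 1) ≠ 0 := by
    by_contra! hc
    refine ht' (Matrix.ext fun a b => ?_)
    have := congrFun (hc b) a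
    simpa using this
  let g : I →ₗ[T] (X → ℂ) :=
    (LinearMap.toSpanSingleton T (X → ℂ) (Pi.single y 1)).comp I.subtype
  have hg : Function.Injective g := by
    refine (LinearMap.injective_or_eq_zero g).resolve_right fun h0 => hy ?_
    exact congrArg (fun k : I →ₗ[T] (X → ℂ) => k t) h0
  let e := LinearEquiv.ofInjective g hg
  exact ⟨LinearMap.range g, IsSimpleModule.congr e.symm, ⟨f.trans e⟩⟩

/-- By `mul_col`, the column space of `U` is already stable under `T`, so taking the `T`-span adds
nothing. -/
theorem mem_primary_iff (h : IsWedderburnFrame T U U' F) (v : X → ℂ) :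
    v ∈ primary T U ↔ ∃ a, U.mulVec a = v := by
  refine ⟨fun hv => ?_, fun ⟨a, ha⟩ => ha ▸ mulVec_mem_primary a⟩
  induction hv using Submodule.span_induction with
  | mem x hx =>
    obtain ⟨i, rfl⟩ := hx
    exact ⟨Pi.single i 1, by simp⟩
  | zero => exact ⟨0, by simp⟩
  | add x y _ _ hx hy =>
    obtain ⟨a, rfl⟩ := hx
    obtain ⟨b, rfl⟩ := hy
    exact ⟨a + b, Matrix.mulVec_add _ _ _⟩
  | smul t x _ hx =>
    obtain ⟨a, rfl⟩ := hx
    obtain ⟨b, c, hbc⟩ := (h.mem_iff t.1).1 t.2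
    refine ⟨b.mulVec a, ?_⟩
    rw [smul_def, hbc, Matrix.mulVec_mulVec, Matrix.mulVec_mulVec, h.mul_col]

/-- If coordinate `j` of `U' w` is nonzero, a rescaled matrix unit of position `(i, j)` sends `w` to
column `i` of `U`. This gives both the simplicity of the primary module and the vanishing of `U'` on
every other simple submodule. -/
theorem primary_le (h : IsWedderburnFrame T U U' F) {W : Submodule T (X → ℂ)} {w : X → ℂ}
    (hw : w ∈ W) (hw' : U'.mulVec w ≠ 0) : primary T U ≤ W := by
  obtain ⟨j, hj⟩ := Function.ne_iff.1 hw'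
  refine Submodule.span_le.2 ?_
  rintro _ ⟨i, rfl⟩
  have key : (⟨U * Matrix.single i j (U'.mulVec w j)⁻¹ * U',
      h.eq_range ▸ h.col_mul_row_mem (Matrix.single i j (U'.mulVec w j)⁻¹)⟩ : T) • w =
      U.col i := by
    rw [smul_def, ← Matrix.mulVec_mulVec, ← Matrix.mulVec_mulVec]
    have : (Matrix.single i j (U'.mulVec w j)⁻¹).mulVec (U'.mulVec w) = Pi.single i 1 := by
      rw [Matrix.single_mulVec]
      simp only [Pi.zero_apply] at hj
      ext k
      by_cases hk : k = i
      · subst hk; simp [inv_mul_cancel₀ hj]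
      · simp [hk]
    rw [this, Matrix.mulVec_single_one]
  change U.col i ∈ W
  rw [← key]
  exact W.smul_mem _ hw

theorem row_mulVec_col (h : IsWedderburnFrame T U U' F) (a : n → ℂ) :
    U'.mulVec (U.mulVec a) = a := by
  rw [Matrix.mulVec_mulVec, h.row_mul_col, Matrix.one_mulVec]

theorem primary_ne_bot [Nonempty n] (h : IsWedderburnFrame T U U' F) : primary T U ≠ ⊥ := by
  obtain ⟨i⟩ := ‹Nonempty n›
  intro h0
  have h1 : U.mulVec (Pi.single i 1) ∈ primary T U := mulVec_mem_primary _
  rw [h0, Submodule.mem_bot] at h1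
  have h2 := h.row_mulVec_col (Pi.single i 1)
  rw [h1, Matrix.mulVec_zero] at h2
  simpa using congrFun h2 i

theorem isSimpleModule_primary [Nonempty n] (h : IsWedderburnFrame T U U' F) :
    IsSimpleModule T (primary T U) := by
  rw [isSimpleModule_iff_isAtom]
  refine ⟨h.primary_ne_bot, fun W hW => by_contra fun hb => hW.not_ge ?_⟩
  obtain ⟨w, hw, hw0⟩ := Submodule.exists_mem_ne_zero_of_ne_bot hb
  obtain ⟨a, rfl⟩ := (h.mem_primary_iff w).1 (hW.le hw)
  refine h.primary_le hw fun h0 => hw0 ?_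
  rw [h.row_mulVec_col] at h0
  rw [h0, Matrix.mulVec_zero]

theorem finrank_primary (h : IsWedderburnFrame T U U' F) :
    Module.finrank ℂ (primary T U) = Fintype.card n := by
  have hinj : Function.Injective U.mulVecLin := fun a b hab => by
    have := congrArg U'.mulVec hab
    simpa only [Matrix.mulVecLin_apply, h.row_mulVec_col] using this
  have hr : (primary T U).restrictScalars ℂ = LinearMap.range U.mulVecLin := by
    ext v
    rw [Submodule.restrictScalars_mem, h.mem_primary_iff]
    rfl
  have h1 := LinearMap.finrank_range_of_inj hinj
  rw [← hr, Module.finrank_fintype_fun_eq_card] at h1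
  exact h1

/-- On the vectors fixed by the idempotent `F i`, the algebra acts by scalars. -/
theorem exists_smul_eq (h : IsWedderburnFrame T U U' F) (t : T) (i : ι) :
    ∃ c : ℂ, ∀ v : X → ℂ, (F i).mulVec v = v → t • v = c • v := by
  obtain ⟨a, c, hac⟩ := (h.mem_iff t.1).1 t.2
  refine ⟨c i, fun v hv => ?_⟩
  rw [smul_def, ← hv, Matrix.mulVec_mulVec, hac, h.mul_idem, Matrix.smul_mulVec]

/-- The isotypic component of the standard module that belongs to `F i`. -/
def isotypic (h : IsWedderburnFrame T U U' F) (i : ι) : Submodule T (X → ℂ) where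
  carrier := {v | (F i).mulVec v = v}
  zero_mem' := Matrix.mulVec_zero _
  add_mem' {v w} hv hw := by
    simp only [Set.mem_ofPred_eq] at *
    rw [Matrix.mulVec_add, hv, hw]
  smul_mem' t v hv := by
    obtain ⟨c, hc⟩ := h.exists_smul_eq t i
    simp only [Set.mem_ofPred_eq] at *
    rw [hc v hv, Matrix.mulVec_smul, hv]

theorem mem_isotypic (h : IsWedderburnFrame T U U' F) (i : ι) (v : X → ℂ) :
    v ∈ h.isotypic i ↔ (F i).mulVec v = v := Iff.rfl

theorem eq_zero_of_mem_isotypic (h : IsWedderburnFrame T U U' F) {i j : ι} (hij : i ≠ j)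
    {v : X → ℂ} (hi : v ∈ h.isotypic i) (hj : v ∈ h.isotypic j) : v = 0 := by
  rw [mem_isotypic] at hi hj
  rw [← hi, ← hj, Matrix.mulVec_mulVec, h.idem_mul_of_ne i j hij, Matrix.zero_mulVec]

theorem not_primary_le_isotypic [Nonempty n] (h : IsWedderburnFrame T U U' F) (i : ι) :
    ¬ primary T U ≤ h.isotypic i := by
  intro hle
  refine h.primary_ne_bot ((Submodule.eq_bot_iff _).2 fun v hv => ?_)
  have h1 := hle hv
  obtain ⟨a, rfl⟩ := (h.mem_primary_iff v).1 hv
  rw [mem_isotypic] at h1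
  rw [← h1, Matrix.mulVec_mulVec, h.idem_mul_col, Matrix.zero_mulVec]

/-- Since `U'` kills `W`, the resolution of the identity reads `w = ∑ F i w` there. Some `F i w` is
nonzero, so `W` meets that isotypic component and, being simple, lies in it. -/
theorem exists_le_isotypic [Nonempty n] (h : IsWedderburnFrame T U U' F)
    {W : Submodule T (X → ℂ)} (hW : IsSimpleModule T W) (hne : W ≠ primary T U) :
    ∃ i, W ≤ h.isotypic i := by
  rw [isSimpleModule_iff_isAtom] at hW
  obtain ⟨w, hw, hw0⟩ := Submodule.exists_mem_ne_zero_of_ne_bot hW.1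
  have hU : U'.mulVec w = 0 := by
    by_contra hc
    rcases hW.le_iff.1 (h.primary_le hw hc) with h1 | h1
    · exact h.primary_ne_bot h1
    · exact hne h1.symm
  have h1 : ∑ i, (F i).mulVec w = w := by
    have := congrArg (fun A : Matrix X X ℂ => A.mulVec w) h.sum_eq_one
    simpa only [Matrix.add_mulVec, ← Matrix.mulVec_mulVec, hU, Matrix.mulVec_zero, zero_add,
      Matrix.one_mulVec, Matrix.sum_mulVec] using this
  obtain ⟨i, hi⟩ : ∃ i, (F i).mulVec w ≠ 0 := by
    by_contra! hc
    exact hw0 (by rw [← h1]; exact Finset.sum_eq_zero fun i _ => hc i)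
  refine ⟨i, ?_⟩
  rcases hW.le_iff.1 (inf_le_left : W ⊓ h.isotypic i ≤ W) with h2 | h2
  · refine absurd ?_ hi
    rw [← Submodule.mem_bot T, ← h2]
    refine ⟨W.smul_mem (⟨F i, h.eq_range ▸ h.idem_mem i⟩ : T) hw, ?_⟩
    change (F i).mulVec ((F i).mulVec w) = _
    rw [Matrix.mulVec_mulVec, h.idem_mul_self]
  · exact inf_eq_left.1 h2

/-- A simple module is generated by any nonzero vector `w`, and here `T` acts by scalars, so `T w =
ℂ w`. -/
theorem finrank_eq_one (h : IsWedderburnFrame T U U' F) {W : Submodule T (X → ℂ)}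
    (hW : IsSimpleModule T W) {i : ι} (hi : W ≤ h.isotypic i) : Module.finrank ℂ W = 1 := by
  obtain ⟨hnt, hs⟩ := isSimpleModule_iff_toSpanSingleton_surjective.1 hW
  obtain ⟨w, hw⟩ := exists_ne (0 : W)
  refine (finrank_eq_one_iff_of_nonzero' w hw).2 fun v => ?_
  obtain ⟨t, rfl⟩ := hs w hw v
  obtain ⟨c, hc⟩ := h.exists_smul_eq t i
  exact ⟨c, Subtype.ext (hc w (hi w.2)).symm⟩

/-- Each `t` acts on both lines by the same scalar, so any linear isomorphism between them is
`T`-linear. -/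
theorem nonempty_equiv (h : IsWedderburnFrame T U U' F) {W W' : Submodule T (X → ℂ)}
    (hW : IsSimpleModule T W) (hW' : IsSimpleModule T W') {i : ι} (hi : W ≤ h.isotypic i)
    (hi' : W' ≤ h.isotypic i) : Nonempty (W ≃ₗ[T] W') := by
  have h1 : Module.finrank ℂ (W.restrictScalars ℂ) = 1 := h.finrank_eq_one hW hi
  have h2 : Module.finrank ℂ (W'.restrictScalars ℂ) = 1 := h.finrank_eq_one hW' hi'
  let f := LinearEquiv.ofFinrankEq _ _ (h1.trans h2.symm)
  refine ⟨{ toFun := f, invFun := f.symm, left_inv := f.left_inv, right_inv := f.right_inv,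
            map_add' := f.map_add, map_smul' := fun t w => ?_ }⟩
  obtain ⟨c, hc⟩ := h.exists_smul_eq t i
  have h3 : t • w = (c • w : W) := Subtype.ext (hc w (hi w.2))
  have h4 : t • (f w : W') = (c • f w : W') := Subtype.ext (hc _ (hi' (f w).2))
  rw [RingHom.id_apply, h3]
  exact (f.map_smul c w).trans h4.symm

-- `F i` is the identity on `W`, hence on its image in `W'`. A vector fixed by both `F i` and `F j`
-- with `i ≠ j` vanishes.
set_option synthInstance.maxHeartbeats 200000 in
theorem eq_of_equiv (h : IsWedderburnFrame T U U' F) {W W' : Submodule T (X → ℂ)}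
    (hW : IsSimpleModule T W) {i j : ι} (hi : W ≤ h.isotypic i) (hj : W' ≤ h.isotypic j)
    (f : W ≃ₗ[T] W') : i = j := by
  by_contra hij
  have := IsSimpleModule.nontrivial T W
  obtain ⟨w, hw⟩ := exists_ne (0 : W)
  refine hw (f.map_eq_zero_iff.1 (Subtype.ext ?_))
  refine h.eq_zero_of_mem_isotypic hij ?_ (hj (f w).2)
  let t : T := ⟨F i, h.eq_range ▸ h.idem_mem i⟩
  have h2 : f (t • w) = t • f w := f.map_smul t w
  rw [show t • w = w from Subtype.ext (hi w.2)] at h2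
  exact (congrArg Subtype.val h2).symm

theorem exists_simple_le_isotypic (h : IsWedderburnFrame T U U' F) (i : ι) :
    ∃ W : Submodule T (X → ℂ), IsSimpleModule T W ∧ W ≤ h.isotypic i := by
  obtain ⟨y, hy⟩ : ∃ y, (F i).mulVec (Pi.single y 1) ≠ 0 := by
    by_contra! hc
    refine h.idem_ne_zero i (Matrix.ext fun a b => ?_)
    have := congrFun (hc b) a
    simpa using this
  have := h.isSemisimpleRing
  have hne : h.isotypic i ≠ ⊥ := fun h0 => hy <| by
    rw [← Submodule.mem_bot T, ← h0, mem_isotypic, Matrix.mulVec_mulVec, h.idem_mul_self]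
  obtain ⟨W, hW, hle⟩ := (IsAtomic.eq_bot_or_exists_atom_le (h.isotypic i)).resolve_left hne
  exact ⟨W, isSimpleModule_iff_isAtom.2 hW, hle⟩

end IsWedderburnFrame

/-! ### The wreath power as an ultrametric space -/

namespace AssociationScheme

/-- The last entry belongs to the outermost factor `K_m`, whose only nontrivial index `1` is shifted
by `d`. -/
theorem rel_wreathPower_succ {m : ℕ} (hm : 2 ≤ m) (d : ℕ) (p q : Fin (d + 1) → Fin m) :
    ((wreathPower m hm (d + 1)).rel p q).val =
      if p (Fin.last d) = q (Fin.last d) then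
        ((wreathPower m hm d).rel (Fin.init p) (Fin.init q)).val
      else d + 1 := by
  change (wreathRel (wreathPower m hm d) (oneClass m hm) (Fin.init p, p (Fin.last d))
    (Fin.init q, q (Fin.last d))).val = _
  rw [wreathRel_val]
  by_cases h : p (Fin.last d) = q (Fin.last d)
  · simp [h]
  · simp [h, oneClass]

/-- The relation index of two tuples is the position of the last entry in which they differ. -/
theorem rel_wreathPower_le_iff {m : ℕ} (hm : 2 ≤ m) {d : ℕ} (p q : Fin d → Fin m) (k : ℕ) :
    ((wreathPower m hm d).rel p q).val ≤ k ↔ ∀ j : Fin d, k ≤ j.val → p j = q j := by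
  induction d with
  | zero =>
    have := ((wreathPower m hm 0).rel p q).isLt
    exact ⟨fun _ j => j.elim0, fun _ => by omega⟩
  | succ d ih =>
    rw [rel_wreathPower_succ]
    split_ifs with h
    · rw [ih]
      constructor
      · intro H j
        induction j using Fin.lastCases with
        | last => exact fun _ => h
        | cast j => exact H j
      · exact fun H j hj => H j.castSucc hj
    · refine ⟨fun hk j hj => absurd j.isLt (by omega), fun H => by_contra fun hk => h ?_⟩
      exact H _ (by simp only [Fin.val_last]; omega)

/-- The relations of the scheme are the spheres of an ultrametric, and every sphere contains
two points at the same distance from each other as from the center. -/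
structure IsUltrametric {X : Type*} [Fintype X] {d : ℕ} (S : AssociationScheme X d) : Prop where
  symm : ∀ x y, S.rel x y = S.rel y x
  le_trans : ∀ x y z k, S.rel x y ≤ k → S.rel y z ≤ k → S.rel x z ≤ k
  triangle : ∀ x k, k ≠ 0 → ∃ y z, S.rel x y = k ∧ S.rel x z = k ∧ S.rel y z = k

theorem isUltrametric_wreathPower {m : ℕ} (hm : 3 ≤ m) (d : ℕ) :
    (wreathPower m (Nat.le_of_succ_le hm) d).IsUltrametric where
  symm x y := by
    refine le_antisymm ?_ ?_ <;> rw [Fin.le_def, rel_wreathPower_le_iff] <;> intro j hj <;>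
      exact ((rel_wreathPower_le_iff _ _ _ _).1 le_rfl j hj).symm
  le_trans x y z k hxy hyz := by
    rw [Fin.le_def, rel_wreathPower_le_iff] at *
    exact fun j hj => (hxy j hj).trans (hyz j hj)
  triangle x k hk := by
    have hk0 : k.val ≠ 0 := fun h => hk (Fin.ext h)
    -- Relation `k` concerns the entry with zero-based index `k - 1`. Tuples differing only there
    -- are in relation `k`.
    let j : Fin d := ⟨k.val - 1, by omega⟩
    have key : ∀ p q : Fin d → Fin m, p j ≠ q j → (∀ i, i ≠ j → p i = q i) →
        (wreathPower m (Nat.le_of_succ_le hm) d).rel p q = k := fun p q hne heq => by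
      refine le_antisymm ?_ ?_
      · rw [Fin.le_def, rel_wreathPower_le_iff]
        refine fun i hi => heq i fun hij => ?_
        have : i.val = k.val - 1 := congrArg Fin.val hij
        omega
      · by_contra hlt
        refine hne ((rel_wreathPower_le_iff (Nat.le_of_succ_le hm) p q (k.val - 1)).1 ?_ j le_rfl)
        have := Fin.lt_def.1 (not_le.1 hlt)
        omega
    -- Three different values of one entry are needed for an equilateral triangle; this is where `3
    -- ≤ m` enters.
    obtain ⟨a, ha⟩ : ∃ a, a ∉ ({x j} : Finset (Fin m)) := by
      by_contra! hc
      have := Finset.card_le_card (fun a _ => hc a : Finset.univ ⊆ ({x j} : Finset (Fin m)))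
      simp at this
      omega
    obtain ⟨b, hb⟩ : ∃ b, b ∉ ({x j, a} : Finset (Fin m)) := by
      by_contra! hc
      have := Finset.card_le_card (fun a _ => hc a : Finset.univ ⊆ ({x j, a} : Finset (Fin m)))
      have h2 := Finset.card_le_two (a := x j) (b := a)
      simp at this
      omega
    simp only [Finset.mem_insert, Finset.mem_singleton, not_or] at ha hb
    refine ⟨Function.update x j a, Function.update x j b, key _ _ ?_ ?_, key _ _ ?_ ?_,
      key _ _ ?_ ?_⟩
    · simpa using Ne.symm ha
    · intro i hi; simp [hi]
    · simpa using Ne.symm hb.1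
    · intro i hi; simp [hi]
    · simpa using Ne.symm hb.2
    · intro i hi; simp [hi]

end AssociationScheme

/-! ### Averaging over balls inside a sphere -/

namespace AssociationScheme

section Ultrametric

variable {X : Type*} [Fintype X] {d : ℕ}

namespace IsUltrametric

variable {S : AssociationScheme X d}

theorem rel_self (S : AssociationScheme X d) (y : X) : S.rel y y = 0 := (S.diag y y).2 rfl

theorem val_le_trans (h : S.IsUltrametric) {x y z : X} {k : ℕ} (hxy : (S.rel x y).val ≤ k)
    (hyz : (S.rel y z).val ≤ k) : (S.rel x z).val ≤ k := by
  by_cases hk : k < d + 1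
  · exact h.le_trans x y z ⟨k, hk⟩ hxy hyz
  · exact (Fin.is_le _).trans (by omega)

/-- Triangles are isosceles. -/
theorem rel_eq_of_lt (h : S.IsUltrametric) {x y z : X} (hlt : S.rel y z < S.rel x y) :
    S.rel x z = S.rel x y := by
  refine le_antisymm (h.le_trans x y z _ le_rfl hlt.le) (not_lt.1 fun h1 => ?_)
  have h2 : (S.rel x y).val ≤ max (S.rel x z).val (S.rel y z).val :=
    h.val_le_trans (le_max_left _ _) (h.symm z y ▸ le_max_right _ _)
  rw [Fin.lt_def] at hlt h1
  omega

theorem exists_rel_eq (h : S.IsUltrametric) (x : X) (k : Fin (d + 1)) : ∃ y, S.rel x y = k := by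
  by_cases hk : k = 0
  · exact ⟨x, by rw [hk, rel_self]⟩
  · obtain ⟨y, -, hy, -⟩ := h.triangle x k hk
    exact ⟨y, hy⟩

/-- Used to show that the idempotents are nonzero. For `k + 1 < i`, moving from `y` by distance `k +
1` stays on the sphere, since triangles are isosceles. For `k + 1 = i` an equilateral triangle is
required. -/
theorem exists_rel_succ (h : S.IsUltrametric) (x : X) (i : Fin (d + 1)) (k : ℕ) (hk : k < i) :
    ∃ y z, S.rel x y = i ∧ S.rel x z = i ∧ (S.rel y z).val = k + 1 := by
  by_cases hki : k + 1 = i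
  · obtain ⟨y, z, hy, hz, hyz⟩ := h.triangle x i (fun h0 => by rw [h0] at hk; simp at hk)
    exact ⟨y, z, hy, hz, by rw [hyz, hki]⟩
  · obtain ⟨y, hy⟩ := h.exists_rel_eq x i
    obtain ⟨z, hz⟩ := h.exists_rel_eq y ⟨k + 1, by omega⟩
    refine ⟨y, z, hy, ?_, by rw [hz]⟩
    rw [h.rel_eq_of_lt, hy]
    rw [hz, hy, Fin.lt_def]
    simp only
    omega

end IsUltrametric

/-- A ball is a disjoint union of spheres, and the sphere sizes do not depend on the center. -/
theorem card_ball_eq (S : AssociationScheme X d) (k : ℕ) (x y : X) :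
    (Finset.univ.filter fun z => (S.rel x z).val ≤ k).card =
      (Finset.univ.filter fun z => (S.rel y z).val ≤ k).card := by
  have key : ∀ a : X, (Finset.univ.filter fun z => (S.rel a z).val ≤ k).card =
      ∑ j ∈ Finset.range (k + 1), (Finset.univ.filter fun z => (S.rel a z).val = j).card := by
    intro a
    rw [Finset.card_eq_sum_card_fiberwise (f := fun z => (S.rel a z).val)
      (t := Finset.range (k + 1)) (fun z hz => by simpa [Nat.lt_succ_iff] using hz)]
    refine Finset.sum_congr rfl fun j hj => ?_
    rw [Finset.filter_filter]
    congr 1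
    ext z
    simp only [Finset.mem_range] at hj
    simp only [Finset.mem_filter, Finset.mem_univ, true_and]
    omega
  rw [key, key]
  exact Finset.sum_congr rfl fun j _ => (S.card_out_eq_in j x x).trans (S.card_out_eq_in j y x).symm

/-- The number of points at distance `i` from `x` that lie in the ball of radius `k` around
one of them. -/
def blockSize (S : AssociationScheme X d) (x : X) (i : Fin (d + 1)) (k : ℕ) : ℕ :=
  if k < i then (Finset.univ.filter fun z => (S.rel x z).val ≤ k).card
  else (Finset.univ.filter fun z => S.rel x z = i).card

/-- For `k < i` the ball around `y` lies entirely in the sphere and has the size of a ball around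
`x`. For `k ≥ i` it contains the whole sphere. -/
theorem IsUltrametric.card_block {S : AssociationScheme X d} (h : S.IsUltrametric) {x y : X}
    {i : Fin (d + 1)} (hy : S.rel x y = i) (k : ℕ) :
    (Finset.univ.filter fun z => S.rel x z = i ∧ (S.rel y z).val ≤ k).card =
      S.blockSize x i k := by
  subst hy
  unfold blockSize
  split_ifs with hk
  · rw [S.card_ball_eq k x y]
    congr 1
    ext z
    simp only [Finset.mem_filter, Finset.mem_univ, true_and, and_iff_right_iff_imp]
    exact fun hz => h.rel_eq_of_lt (Fin.lt_def.2 (hz.trans_lt hk))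
  · congr 1
    ext z
    simp only [Finset.mem_filter, Finset.mem_univ, true_and, and_iff_left_iff_imp]
    intro hz
    have h1 : (S.rel y z).val ≤ (S.rel x y).val :=
      h.val_le_trans (h.symm x y ▸ le_rfl) (le_of_eq (congrArg Fin.val hz))
    exact h1.trans (not_lt.1 hk)

theorem IsUltrametric.blockSize_ne_zero {S : AssociationScheme X d} (h : S.IsUltrametric) (x : X)
    (i : Fin (d + 1)) (k : ℕ) : (S.blockSize x i k : ℂ) ≠ 0 := by
  obtain ⟨y, hy⟩ := h.exists_rel_eq x i
  rw [Nat.cast_ne_zero, ← h.card_block hy, Finset.card_ne_zero]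
  exact ⟨y, by simp [hy, IsUltrametric.rel_self]⟩

theorem IsUltrametric.blockSize_zero {S : AssociationScheme X d} (h : S.IsUltrametric) (x : X)
    (i : Fin (d + 1)) : S.blockSize x i 0 = 1 := by
  obtain ⟨y, hy⟩ := h.exists_rel_eq x i
  rw [← h.card_block hy, Finset.card_eq_one]
  refine ⟨y, ?_⟩
  ext z
  simp only [Finset.mem_filter, Finset.mem_univ, true_and, Nat.le_zero, S.rel_val_eq_zero,
    Finset.mem_singleton]
  exact ⟨fun h => h.2.symm, fun h => by rw [h]; exact ⟨hy, rfl⟩⟩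

/-- The characteristic vectors of the subconstituents, as the columns of a matrix. -/
def shell (S : AssociationScheme X d) (x : X) : Matrix X (Fin (d + 1)) ℂ :=
  Matrix.of fun y i => if S.rel x y = i then 1 else 0

/-- The averages over the subconstituents, as the rows of a matrix. -/
noncomputable def shellMean (S : AssociationScheme X d) (x : X) : Matrix (Fin (d + 1)) X ℂ :=
  Matrix.of fun i y => if S.rel x y = i then (S.blockSize x i i : ℂ)⁻¹ else 0

/-- The operator on functions supported on the `i`-th subconstituent that averages over balls of
radius `k`. -/
noncomputable def blockMean (S : AssociationScheme X d) (x : X) (i : Fin (d + 1)) (k : ℕ) :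
    Matrix X X ℂ :=
  Matrix.of fun y z =>
    if S.rel x y = i ∧ S.rel x z = i ∧ (S.rel y z).val ≤ k then (S.blockSize x i k : ℂ)⁻¹ else 0

/-- The projection onto the functions on the `i`-th subconstituent that are constant on balls
of radius `k` and have mean zero on balls of radius `k + 1`. -/
noncomputable def blockIdempotent (S : AssociationScheme X d) (x : X)
    (p : Σ i : Fin (d + 1), Fin i) : Matrix X X ℂ :=
  S.blockMean x p.1 p.2 - S.blockMean x p.1 (p.2 + 1)

theorem blockMean_apply (S : AssociationScheme X d) (x : X) (i : Fin (d + 1)) (k : ℕ) (y z : X) :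
    S.blockMean x i k y z = if S.rel x y = i ∧ S.rel x z = i ∧ (S.rel y z).val ≤ k then
      (S.blockSize x i k : ℂ)⁻¹ else 0 := rfl

theorem shell_mul_mul_shellMean_apply (S : AssociationScheme X d) (x : X)
    (a : Matrix (Fin (d + 1)) (Fin (d + 1)) ℂ) (y z : X) :
    (S.shell x * a * S.shellMean x) y z = a (S.rel x y) (S.rel x z) *
      (S.blockSize x (S.rel x z) (S.rel x z) : ℂ)⁻¹ := by
  simp [Matrix.mul_apply, shell, shellMean]

theorem blockMean_mul_of_ne (S : AssociationScheme X d) (x : X) {i j : Fin (d + 1)} (hij : i ≠ j)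
    (k l : ℕ) : S.blockMean x i k * S.blockMean x j l = 0 := by
  ext y z
  rw [Matrix.mul_apply, Matrix.zero_apply]
  refine Finset.sum_eq_zero fun w _ => ?_
  rw [blockMean_apply, blockMean_apply]
  by_cases hw : S.rel x w = i
  · rw [if_neg (c := S.rel x w = j ∧ _) fun h => hij (hw.symm.trans h.1), mul_zero]
  · rw [if_neg fun h => hw h.2.1, zero_mul]

namespace IsUltrametric

variable {S : AssociationScheme X d}

theorem blockMean_transpose (h : S.IsUltrametric) (x : X) (i : Fin (d + 1)) (k : ℕ) :
    (S.blockMean x i k).transpose = S.blockMean x i k := by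
  ext y z
  rw [Matrix.transpose_apply, blockMean_apply, blockMean_apply, h.symm z y]
  simp only [and_left_comm]

/-- Averages over large balls are constant on the small balls inside them. In entries, if `y` and
`z` share an `l`-ball, the intermediate points are exactly the `k`-ball of `y` in the sphere, and
their number cancels one normalization. -/
theorem blockMean_mul_of_le (h : S.IsUltrametric) (x : X) (i : Fin (d + 1)) {k l : ℕ}
    (hkl : k ≤ l) : S.blockMean x i k * S.blockMean x i l = S.blockMean x i l := by
  ext y z
  rw [Matrix.mul_apply]
  simp only [blockMean_apply]
  by_cases hyz : S.rel x y = i ∧ S.rel x z = i ∧ (S.rel y z).val ≤ l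
  · have key : ∀ w, (if S.rel x y = i ∧ S.rel x w = i ∧ (S.rel y w).val ≤ k then
        (S.blockSize x i k : ℂ)⁻¹ else 0) *
        (if S.rel x w = i ∧ S.rel x z = i ∧ (S.rel w z).val ≤ l then
          (S.blockSize x i l : ℂ)⁻¹ else 0) =
        if S.rel x w = i ∧ (S.rel y w).val ≤ k then
          (S.blockSize x i k : ℂ)⁻¹ * (S.blockSize x i l : ℂ)⁻¹ else 0 := by
      intro w
      by_cases hw : S.rel x w = i ∧ (S.rel y w).val ≤ k
      · have h1 : (S.rel w z).val ≤ l :=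
          h.val_le_trans (h.symm y w ▸ hw.2.trans hkl) hyz.2.2
        rw [if_pos hw, if_pos ⟨hyz.1, hw⟩, if_pos ⟨hw.1, hyz.2.1, h1⟩]
      · rw [if_neg hw, if_neg fun h' => hw h'.2, zero_mul]
    rw [Finset.sum_congr rfl fun w _ => key w, ← Finset.sum_filter, Finset.sum_const,
      h.card_block hyz.1, if_pos hyz, nsmul_eq_mul,
      mul_inv_cancel_left₀ (h.blockSize_ne_zero x i k)]
  · rw [if_neg hyz]
    refine Finset.sum_eq_zero fun w _ => ?_
    by_cases hw : S.rel x y = i ∧ S.rel x w = i ∧ (S.rel y w).val ≤ k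
    · rw [if_neg (c := S.rel x w = i ∧ _) fun h' => hyz ⟨hw.1, h'.2.1,
        h.val_le_trans (hw.2.2.trans hkl) h'.2.2⟩, mul_zero]
    · rw [if_neg hw, zero_mul]

theorem blockMean_mul (h : S.IsUltrametric) (x : X) (i : Fin (d + 1)) (k l : ℕ) :
    S.blockMean x i k * S.blockMean x i l = S.blockMean x i (max k l) := by
  rcases le_total k l with hkl | hkl
  · rw [h.blockMean_mul_of_le x i hkl, max_eq_right hkl]
  · rw [max_eq_left hkl]
    -- The averaging matrices are symmetric, so transposing gives the opposite order.
    have := congrArg Matrix.transpose (h.blockMean_mul_of_le x i hkl)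
    rwa [Matrix.transpose_mul, h.blockMean_transpose, h.blockMean_transpose] at this

/-- Two points of the sphere of radius `i` are at distance at most `i`, so averaging at that radius
is averaging over the whole sphere. This links the two families of basis elements. -/
theorem shell_mul_single_mul_shellMean (h : S.IsUltrametric) (x : X) (i : Fin (d + 1)) :
    S.shell x * Matrix.single i i (1 : ℂ) * S.shellMean x = S.blockMean x i i := by
  ext y z
  rw [Matrix.mul_assoc, Matrix.mul_apply, Finset.sum_eq_single i]
  · rw [Matrix.single_mul_apply_same, one_mul, blockMean_apply]
    by_cases hy : S.rel x y = i
    · by_cases hz : S.rel x z = i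
      · have : (S.rel y z).val ≤ i := h.val_le_trans (h.symm x y ▸ hy.le) hz.le
        simp [shell, shellMean, hy, hz, this]
      · simp [shell, shellMean, hz]
    · simp [shell, hy]
  · intro j _ hj
    rw [Matrix.single_mul_apply_of_ne _ _ _ _ _ hj, mul_zero]
  · simp

theorem shell_mul_shellMean (h : S.IsUltrametric) (x : X) :
    S.shell x * S.shellMean x = ∑ i, S.blockMean x i i := by
  simp only [← h.shell_mul_single_mul_shellMean]
  rw [← Matrix.sum_mul, ← Matrix.mul_sum, Matrix.sum_single_one, Matrix.mul_one]

theorem shellMean_mul_shell (h : S.IsUltrametric) (x : X) : S.shellMean x * S.shell x = 1 := by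
  ext i j
  rw [Matrix.mul_apply]
  by_cases hij : i = j
  · subst hij
    have key : ∀ y, S.shellMean x i y * S.shell x y i =
        if S.rel x y = i then (S.blockSize x i i : ℂ)⁻¹ else 0 := fun y => by
      by_cases hy : S.rel x y = i <;> simp [shell, shellMean, hy]
    have hc : (Finset.univ.filter fun y => S.rel x y = i).card = S.blockSize x i i := by
      rw [blockSize, if_neg (lt_irrefl _)]
    rw [Matrix.one_apply_eq, Finset.sum_congr rfl fun y _ => key y, ← Finset.sum_filter,
      Finset.sum_const, nsmul_eq_mul, hc, mul_inv_cancel₀ (h.blockSize_ne_zero x i i)]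
  · rw [Matrix.one_apply_ne hij]
    refine Finset.sum_eq_zero fun y _ => ?_
    by_cases hy : S.rel x y = i
    · simp [shell, hy, hij]
    · simp [shellMean, hy]

/-- On one sphere the smaller radius is absorbed by the larger, so the four terms cancel in pairs.
Operators on different spheres have product zero. -/
theorem blockIdempotent_mul (h : S.IsUltrametric) (x : X) (p q : Σ i : Fin (d + 1), Fin i)
    (hpq : p ≠ q) : S.blockIdempotent x p * S.blockIdempotent x q = 0 := by
  obtain ⟨i, k⟩ := p
  obtain ⟨j, l⟩ := q
  unfold blockIdempotent
  by_cases hij : i = j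
  · subst hij
    have hkl : k.val ≠ l.val := fun h0 => hpq (by rw [Fin.ext h0])
    rw [sub_mul, mul_sub, mul_sub, h.blockMean_mul, h.blockMean_mul, h.blockMean_mul,
      h.blockMean_mul]
    simp only
    rcases lt_or_gt_of_ne hkl with h1 | h1
    · rw [max_eq_right (by omega), max_eq_right (by omega), max_eq_right (by omega),
        max_eq_right (by omega), sub_self]
    · rw [max_eq_left (by omega), max_eq_left (by omega), max_eq_left (by omega),
        max_eq_left (by omega)]
      abel
  · simp [sub_mul, mul_sub, blockMean_mul_of_ne S x hij]

theorem blockIdempotent_mul_self (h : S.IsUltrametric) (x : X) (p : Σ i : Fin (d + 1), Fin i) :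
    S.blockIdempotent x p * S.blockIdempotent x p = S.blockIdempotent x p := by
  unfold blockIdempotent
  rw [sub_mul, mul_sub, mul_sub, h.blockMean_mul, h.blockMean_mul, h.blockMean_mul,
    h.blockMean_mul]
  simp

theorem blockMean_mul_blockIdempotent (h : S.IsUltrametric) (x : X) (i : Fin (d + 1))
    (p : Σ i : Fin (d + 1), Fin i) : S.blockMean x i i * S.blockIdempotent x p = 0 := by
  obtain ⟨j, l⟩ := p
  unfold blockIdempotent
  by_cases hij : i = j
  · subst hij
    simp only
    rw [mul_sub, h.blockMean_mul, h.blockMean_mul, max_eq_left (by omega), max_eq_left (by omega),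
      sub_self]
  · simp [mul_sub, blockMean_mul_of_ne S x hij]

theorem shellMean_mul_blockIdempotent (h : S.IsUltrametric) (x : X)
    (p : Σ i : Fin (d + 1), Fin i) : S.shellMean x * S.blockIdempotent x p = 0 := by
  calc S.shellMean x * S.blockIdempotent x p
      -- Inserting the identity `shellMean * shell = 1` produces `shell * shellMean`, a sum of ball
      -- averages whose products with the idempotent are known.
      = S.shellMean x * S.shell x * (S.shellMean x * S.blockIdempotent x p) := by
        rw [h.shellMean_mul_shell, Matrix.one_mul]
    _ = S.shellMean x * (S.shell x * S.shellMean x * S.blockIdempotent x p) := by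
        simp only [Matrix.mul_assoc]
    _ = 0 := by
        rw [h.shell_mul_shellMean, Finset.sum_mul, Finset.sum_eq_zero, Matrix.mul_zero]
        exact fun i _ => h.blockMean_mul_blockIdempotent x i p

theorem blockIdempotent_mul_shell (h : S.IsUltrametric) (x : X)
    (p : Σ i : Fin (d + 1), Fin i) : S.blockIdempotent x p * S.shell x = 0 := by
  have hp : (S.blockIdempotent x p).transpose = S.blockIdempotent x p := by
    rw [blockIdempotent, Matrix.transpose_sub, h.blockMean_transpose, h.blockMean_transpose]
  have h0 : ∀ i, S.blockIdempotent x p * S.blockMean x i i = 0 := fun i => by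
    rw [← Matrix.transpose_inj, Matrix.transpose_mul, hp, h.blockMean_transpose,
      h.blockMean_mul_blockIdempotent, Matrix.transpose_zero]
  calc S.blockIdempotent x p * S.shell x
      = S.blockIdempotent x p * S.shell x * (S.shellMean x * S.shell x) := by
        rw [h.shellMean_mul_shell, Matrix.mul_one]
    _ = S.blockIdempotent x p * (S.shell x * S.shellMean x) * S.shell x := by
        simp only [Matrix.mul_assoc]
    _ = 0 := by
        rw [h.shell_mul_shellMean, Finset.mul_sum, Finset.sum_eq_zero fun i _ => h0 i,
          Matrix.zero_mul]

/-- At two points of the sphere at distance exactly `k + 1`, the first average has entry zero and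
the second does not. -/
theorem blockIdempotent_ne_zero (h : S.IsUltrametric) (x : X) (p : Σ i : Fin (d + 1), Fin i) :
    S.blockIdempotent x p ≠ 0 := by
  obtain ⟨i, k⟩ := p
  obtain ⟨y, z, hy, hz, hyz⟩ := h.exists_rel_succ x i k k.isLt
  intro h0
  have h1 := congrFun (congrFun h0 y) z
  have h2 := h.blockSize_ne_zero x i (k.val + 1)
  simp [blockIdempotent, blockMean_apply, hy, hz, hyz] at h1
  exact h2 (by exact_mod_cast h1)

variable [DecidableEq X]

theorem blockMean_zero (h : S.IsUltrametric) (x : X) (i : Fin (d + 1)) :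
    S.blockMean x i 0 = S.dualIdempotent x i := by
  ext y z
  rw [blockMean_apply, h.blockSize_zero, dualIdempotent, Matrix.diagonal_apply]
  simp only [Nat.le_zero, S.rel_val_eq_zero, Nat.cast_one, inv_one]
  by_cases hyz : y = z
  · subst hyz; simp
  · simp [hyz]

theorem isWedderburnSystem (h : S.IsUltrametric) (x : X) :
    IsWedderburnSystem (S.shell x) (S.shellMean x) (S.blockIdempotent x) where
  row_mul_col := h.shellMean_mul_shell x
  idem_mul_col := h.blockIdempotent_mul_shell x
  row_mul_idem := h.shellMean_mul_blockIdempotent x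
  idem_mul_self := h.blockIdempotent_mul_self x
  idem_mul_of_ne := h.blockIdempotent_mul x
  idem_ne_zero := h.blockIdempotent_ne_zero x
  sum_eq_one := by
    rw [h.shell_mul_shellMean, Fintype.sum_sigma, ← Finset.sum_add_distrib]
    -- The sum telescopes from radius `i` down to radius `0`, where averaging does nothing.
    have key : ∀ i : Fin (d + 1), S.blockMean x i i + ∑ k : Fin i, S.blockIdempotent x ⟨i, k⟩ =
        S.dualIdempotent x i := by
      intro i
      simp only [blockIdempotent]
      rw [Fin.sum_univ_eq_sum_range (fun k => S.blockMean x i k - S.blockMean x i (k + 1)) i,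
        Finset.sum_range_sub', add_sub_cancel, h.blockMean_zero]
    rw [Finset.sum_congr rfl fun i _ => key i]
    ext y z
    rw [Matrix.sum_apply]
    simp only [dualIdempotent, Matrix.diagonal_apply, Matrix.one_apply]
    by_cases hyz : y = z <;> simp [hyz]

theorem blockMean_mem_range (h : S.IsUltrametric) (x : X) (i : Fin (d + 1)) (k : ℕ) (hk : k ≤ i) :
    S.blockMean x i k ∈ (h.isWedderburnSystem x).algHom.range := by
  induction hk using Nat.decreasingInduction with
  | self =>
    rw [← h.shell_mul_single_mul_shellMean]
    exact (h.isWedderburnSystem x).col_mul_row_mem _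
  | of_succ k hk ih =>
    rw [show S.blockMean x i k = S.blockIdempotent x ⟨i, ⟨k, hk⟩⟩ + S.blockMean x i (k + 1) by
      simp [blockIdempotent]]
    exact Subalgebra.add_mem _ ((h.isWedderburnSystem x).idem_mem _) ih

end IsUltrametric

/-! ### The Terwilliger algebra equals the span -/

variable [DecidableEq X]

/-- The adjacency matrix of the relation of being at distance at most `k`. -/
def ballMatrix (S : AssociationScheme X d) (k : ℕ) : Matrix X X ℂ :=
  Matrix.of fun y z => if (S.rel y z).val ≤ k then 1 else 0

theorem adjMatrix_mem_terwilliger (S : AssociationScheme X d) (x : X) (i : Fin (d + 1)) :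
    S.adjMatrix i ∈ S.terwilliger x :=
  (le_sup_left : S.boseMesner ≤ S.terwilliger x) (Algebra.subset_adjoin ⟨i, rfl⟩)

theorem dualIdempotent_mem_terwilliger (S : AssociationScheme X d) (x : X) (i : Fin (d + 1)) :
    S.dualIdempotent x i ∈ S.terwilliger x :=
  (le_sup_right : S.dualBoseMesner x ≤ S.terwilliger x) (Algebra.subset_adjoin ⟨i, rfl⟩)

theorem ballMatrix_mem_terwilliger (S : AssociationScheme X d) (x : X) (k : ℕ) :
    S.ballMatrix k ∈ S.terwilliger x := by
  have : S.ballMatrix k = ∑ l : Fin (d + 1) with l.val ≤ k, S.adjMatrix l := by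
    ext y z
    rw [Matrix.sum_apply]
    simp [ballMatrix, adjMatrix]
  rw [this]
  exact Subalgebra.sum_mem _ fun l _ => S.adjMatrix_mem_terwilliger x l

theorem dualIdempotent_mul_mul_apply (S : AssociationScheme X d) (x : X) (i j : Fin (d + 1))
    (M : Matrix X X ℂ) (y z : X) :
    (S.dualIdempotent x i * M * S.dualIdempotent x j) y z =
      if S.rel x y = i ∧ S.rel x z = j then M y z else 0 := by
  rw [dualIdempotent, dualIdempotent, Matrix.mul_diagonal, Matrix.diagonal_mul]
  by_cases hy : S.rel x y = i <;> by_cases hz : S.rel x z = j <;> simp [hy, hz]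

theorem blockMean_mem_terwilliger (S : AssociationScheme X d) (x : X) (i : Fin (d + 1)) (k : ℕ) :
    S.blockMean x i k ∈ S.terwilliger x := by
  have : S.blockMean x i k = (S.blockSize x i k : ℂ)⁻¹ •
      (S.dualIdempotent x i * S.ballMatrix k * S.dualIdempotent x i) := by
    ext y z
    rw [Matrix.smul_apply, dualIdempotent_mul_mul_apply, blockMean_apply, ballMatrix,
      Matrix.of_apply]
    simp only [ite_and, smul_eq_mul, mul_ite, mul_zero, mul_one]
  rw [this]
  exact Subalgebra.smul_mem _ (Subalgebra.mul_mem _ (Subalgebra.mul_mem _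
    (S.dualIdempotent_mem_terwilliger x i) (S.ballMatrix_mem_terwilliger x k))
    (S.dualIdempotent_mem_terwilliger x i)) _

theorem shell_mul_mul_shellMean_mem (S : AssociationScheme X d) (x : X)
    (a : Matrix (Fin (d + 1)) (Fin (d + 1)) ℂ) :
    S.shell x * a * S.shellMean x ∈ S.terwilliger x := by
  -- `ballMatrix d` is the all-ones matrix; its corners between dual idempotents are the matrix
  -- units up to scale.
  have : S.shell x * a * S.shellMean x = ∑ i, ∑ j, (a i j * (S.blockSize x j j : ℂ)⁻¹) •
      (S.dualIdempotent x i * S.ballMatrix d * S.dualIdempotent x j) := by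
    ext y z
    rw [shell_mul_mul_shellMean_apply, Matrix.sum_apply]
    simp only [Matrix.sum_apply, Matrix.smul_apply, dualIdempotent_mul_mul_apply, ballMatrix,
      Matrix.of_apply, Fin.is_le, if_true, ite_and, smul_eq_mul]
    simp
  rw [this]
  exact Subalgebra.sum_mem _ fun i _ => Subalgebra.sum_mem _ fun j _ => Subalgebra.smul_mem _
    (Subalgebra.mul_mem _ (Subalgebra.mul_mem _
    (S.dualIdempotent_mem_terwilliger x i) (S.ballMatrix_mem_terwilliger x d))
    (S.dualIdempotent_mem_terwilliger x j)) _

namespace IsUltrametric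

variable {S : AssociationScheme X d}

/-- Rows split by the distance of `y` from `x`. If it is at most `k`, the ball of `y` is the ball of
`x`, which gives a combination of matrix units. If it exceeds `k`, the ball stays in the sphere of
`y`, which gives an unnormalized average. -/
theorem ballMatrix_mem_range (h : S.IsUltrametric) (x : X) (k : ℕ) :
    S.ballMatrix k ∈ (h.isWedderburnSystem x).algHom.range := by
  let a : Matrix (Fin (d + 1)) (Fin (d + 1)) ℂ :=
    Matrix.of fun i j => if i.val ≤ k ∧ j.val ≤ k then (S.blockSize x j j : ℂ) else 0
  have : S.ballMatrix k = S.shell x * a * S.shellMean x +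
      ∑ i : Fin (d + 1) with k < i.val, (S.blockSize x i k : ℂ) • S.blockMean x i k := by
    ext y z
    rw [Matrix.add_apply, shell_mul_mul_shellMean_apply, Matrix.sum_apply, Finset.sum_filter]
    simp only [Matrix.smul_apply, blockMean_apply, ite_and, ballMatrix, Matrix.of_apply, a]
    rw [Finset.sum_eq_single (S.rel x y) (fun i _ hi => by simp [hi.symm]) (by simp)]
    by_cases hy : k < (S.rel x y).val
    · have hyz : (S.rel y z).val ≤ k → S.rel x z = S.rel x y := fun h1 =>
        h.rel_eq_of_lt (Fin.lt_def.2 (h1.trans_lt hy))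
      by_cases h1 : (S.rel y z).val ≤ k
      · simp [h1, hyz h1, hy, h.blockSize_ne_zero]
      · simp [h1, hy]
    · have hyz : (S.rel y z).val ≤ k ↔ (S.rel x z).val ≤ k :=
        ⟨h.val_le_trans (not_lt.1 hy), h.val_le_trans (h.symm x y ▸ not_lt.1 hy)⟩
      by_cases h1 : (S.rel x z).val ≤ k
      · simp [hyz, h1, hy, not_lt.1 hy, h.blockSize_ne_zero]
      · simp [hyz, h1, hy]
  rw [this]
  refine Subalgebra.add_mem _ ((h.isWedderburnSystem x).col_mul_row_mem _)
    (Subalgebra.sum_mem _ fun i hi => Subalgebra.smul_mem _ (h.blockMean_mem_range x i k ?_) _)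
  exact (Finset.mem_filter.1 hi).2.le

theorem adjMatrix_mem_range (h : S.IsUltrametric) (x : X) (i : Fin (d + 1)) :
    S.adjMatrix i ∈ (h.isWedderburnSystem x).algHom.range := by
  -- The case `i = 0` is separate because truncated subtraction would make the difference of balls
  -- zero.
  by_cases hi : i.val = 0
  · have : S.adjMatrix i = S.ballMatrix 0 := by
      ext y z
      simp only [adjMatrix, ballMatrix, Matrix.of_apply, Fin.ext_iff, hi, Nat.le_zero]
    rw [this]
    exact h.ballMatrix_mem_range x 0
  · have : S.adjMatrix i = S.ballMatrix i - S.ballMatrix (i - 1) := by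
      ext y z
      simp only [adjMatrix, ballMatrix, Fin.ext_iff, Matrix.sub_apply, Matrix.of_apply]
      split_ifs <;> first | omega | simp
    rw [this]
    exact Subalgebra.sub_mem _ (h.ballMatrix_mem_range x _) (h.ballMatrix_mem_range x _)

theorem terwilliger_eq_range (h : S.IsUltrametric) (x : X) :
    S.terwilliger x = (h.isWedderburnSystem x).algHom.range := by
  refine le_antisymm (sup_le (Algebra.adjoin_le ?_) (Algebra.adjoin_le ?_)) fun t ht => ?_
  · rintro _ ⟨i, rfl⟩
    exact h.adjMatrix_mem_range x i
  · rintro _ ⟨i, rfl⟩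
    rw [← h.blockMean_zero]
    exact h.blockMean_mem_range x i 0 (Nat.zero_le _)
  · obtain ⟨a, c, rfl⟩ := ((h.isWedderburnSystem x).mem_range_algHom t).1 ht
    exact Subalgebra.add_mem _ (S.shell_mul_mul_shellMean_mem x a)
      (Subalgebra.sum_mem _ fun p _ => Subalgebra.smul_mem _ (Subalgebra.sub_mem _
        (S.blockMean_mem_terwilliger x _ _) (S.blockMean_mem_terwilliger x _ _)) _)

theorem isWedderburnFrame (h : S.IsUltrametric) (x : X) :
    IsWedderburnFrame (S.terwilliger x) (S.shell x) (S.shellMean x) (S.blockIdempotent x) :=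
  ⟨h.isWedderburnSystem x, h.terwilliger_eq_range x⟩

end IsUltrametric

/-! ### The primary module, isomorphism classes and conclusion -/

theorem primaryModule_eq (S : AssociationScheme X d) (x : X) :
    S.primaryModule x = IsWedderburnFrame.primary (S.terwilliger x) (S.shell x) := by
  unfold primaryModule IsWedderburnFrame.primary
  congr 2
  funext i y
  simp [dualIdempotent, Matrix.mulVec_diagonal, shell]

/-- The isomorphism classes of nonprimary irreducible submodules correspond to the idempotents
that complement the matrix units. -/
theorem card_isoSetoid {ι : Type*} [Fintype ι] {S : AssociationScheme X d} {x : X}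
    {U' : Matrix (Fin (d + 1)) X ℂ} {F : ι → Matrix X X ℂ}
    (h : IsWedderburnFrame (S.terwilliger x) (S.shell x) U' F) :
    Nat.card (Quotient (S.isoSetoid x)) = Fintype.card ι := by
  choose W hW hle using h.exists_simple_le_isotypic
  -- `F i` kills the columns of `shell` but fixes its own component.
  have hne : ∀ i, W i ≠ S.primaryModule x := fun i h0 =>
    h.not_primary_le_isotypic i (S.primaryModule_eq x ▸ h0 ▸ hle i)
  let f : ι → Quotient (S.isoSetoid x) := fun i => Quotient.mk _ ⟨W i, hW i, hne i⟩
  have hf : Function.Bijective f := by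
    constructor
    · intro i j hij
      obtain ⟨g⟩ := Quotient.exact hij
      exact h.eq_of_equiv (hW i) (hle i) (hle j) g
    · intro q
      induction q using Quotient.inductionOn with
      | h V =>
        obtain ⟨V, hV, hVne⟩ := V
        rw [primaryModule_eq] at hVne
        obtain ⟨i, hi⟩ := h.exists_le_isotypic hV hVne
        exact ⟨i, Quotient.sound (h.nonempty_equiv (hW i) hV (hle i) hi)⟩
  rw [← Nat.card_eq_of_bijective f hf, Nat.card_eq_fintype_card]

end Ultrametric

end AssociationScheme

theorem mainTheorem1 (m d : ℕ) (hm : 3 ≤ m)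
    (S : AssociationScheme (Fin d → Fin m) d)
    (hS : S = AssociationScheme.wreathPower m (Nat.le_of_succ_le hm) d)
    (x : Fin d → Fin m) :
    Module.finrank ℂ (S.terwilliger x) = (d + 1) ^ 2 + d * (d + 1) / 2 ∧
    Nonempty (S.terwilliger x ≃ₐ[ℂ] (Matrix (Fin (d + 1)) (Fin (d + 1)) ℂ ×
      (Fin (d * (d + 1) / 2) → Matrix (Fin 1) (Fin 1) ℂ))) ∧
    (IsSimpleModule (S.terwilliger x) (S.primaryModule x) ∧
      Module.finrank ℂ (S.primaryModule x) = d + 1) ∧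
    (∀ W : Submodule (S.terwilliger x) ((Fin d → Fin m) → ℂ),
      IsSimpleModule (S.terwilliger x) W → W ≠ S.primaryModule x → Module.finrank ℂ W = 1) ∧
    Nat.card (Quotient (S.isoSetoid x)) = d * (d + 1) / 2 ∧
    (∀ (W : Type*) [AddCommGroup W] [Module (S.terwilliger x) W],
      IsSimpleModule (S.terwilliger x) W →
        ∃ W' : Submodule (S.terwilliger x) ((Fin d → Fin m) → ℂ),
          IsSimpleModule (S.terwilliger x) W' ∧
            Nonempty (W ≃ₗ[S.terwilliger x] W')) := by
  have hult : S.IsUltrametric := hS ▸ AssociationScheme.isUltrametric_wreathPower hm d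
  -- The idempotents are indexed by the pairs `k < i ≤ d`.
  have hcard : Fintype.card (Σ i : Fin (d + 1), Fin i) = d * (d + 1) / 2 := by
    rw [Fintype.card_sigma]
    simp only [Fintype.card_fin]
    rw [Fin.sum_univ_eq_sum_range (fun i => i), Finset.sum_range_id, Nat.add_sub_cancel,
      mul_comm]
  have h := (hult.isWedderburnFrame x).reindex (Fintype.equivFinOfCardEq hcard).symm
  refine ⟨?_, ⟨h.algEquiv⟩, ⟨?_, ?_⟩, fun W hW hne => ?_, ?_, h.exists_equiv_submodule⟩
  · simpa using h.finrank_eq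
  · rw [S.primaryModule_eq]
    exact h.isSimpleModule_primary
  · rw [S.primaryModule_eq]
    simpa using h.finrank_primary
  · rw [S.primaryModule_eq] at hne
    obtain ⟨i, hi⟩ := h.exists_le_isotypic hW hne
    exact h.finrank_eq_one hW hi
  · simpa using AssociationScheme.card_isoSetoid h
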